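/- For $p\in\mathbb C$ with $|p|<1$ and $x\in\mathbb C\setminus\{0\}$ let $$\theta(x;p)=\prod_{j\ge 0}(1-p^jx)(1-p^{j+1}/x),\qquad (x;q,p)_n=\prod_{k=0}^{n-1}\theta(xq^k;p),$$ with $\theta(x_1,\dots,x_m;p)=\prod_i\theta(x_i;p)$ and $(x_1,\dots,x_m;q,p)_n=\prod_i(x_i;q,p)_n$. Let $n\ge 0$ be an integer and let $a,q,z\in\mathbb C$ be nonzero, such that $\theta(a^2;p)\neq0$ and $(q,\,a^2q^{n+1},\,aqz,\,aq/z;q,p)_n\ne 0$. Then, for all nonzero $b_1,\dots,b_n\in\mathbb C$, one has the elliptic Karlsson–Minton type identity $$\frac{(a^2q,q;q,p)_n}{(aqz,aq/z;q,p)_n}\prod_{j=1}^n\theta(b_jz,b_j/z;p) =\sum_{k=0}^n q^{k(n+1)}\frac{\theta(a^2q^{2k};p)}{\theta(a^2;p)} \frac{(q^{-n},a^2,az,a/z;q,p)_k}{(q,a^2q^{n+1},aqz,aq/z;q,p)_k} \prod_{j=1}^n\theta(ab_jq^k,b_jq^{-k}/a;p).$$ In particular, for all integers $0\le s\le n$ and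 all nonzero $b,d\in\mathbb C$ with $(ab,\,ad,\,aq^{1-s}/b,\,aq^{1-n+s}/d;q,p)_n\neq 0$, $$\frac{(q,a^2q;q,p)_n}{(aqz,aq/z;q,p)_n}\, \frac{(bz,b/z;q,p)_s\,(dz,d/z;q,p)_{n-s}}{(ab,b/a;q,p)_s\,(ad,d/a;q,p)_{n-s}} ={}_{12}V_{11}\big(a^2;q^{-n},az,a/z,aq/b,aq/d,abq^s,adq^{n-s};q,p\big),$$ where $${}_{12}V_{11}(a_1;c_1,\dots,c_7;q,p)=\sum_{k\ge0}\frac{\theta(a_1q^{2k};p)}{\theta(a_1;p)} \frac{(a_1,c_1,\dots,c_7;q,p)_k}{(q,a_1q/c_1,\dots,a_1q/c_7;q,p)_k}\,q^k ,$$ a series whose terms with $k>n$ vanish here because $c_1=q^{-n}$ (they are read as $0$). -/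

import Mathlib

/-- The modified Jacobi theta function
`θ(x; p) = ∏_{j ≥ 0} (1 - p ^ j x) (1 - p ^ (j + 1) / x)`, used for `x ≠ 0` and `‖p‖ < 1`
(where the product converges absolutely). -/
noncomputable def modTheta (p x : ℂ) : ℂ :=
  ∏' j : ℕ, ((1 - p ^ j * x) * (1 - p ^ (j + 1) / x))

/-- The theta shifted factorial `(x; q, p)_n = ∏_{k < n} θ(x q ^ k; p)`, of natural order `n`. -/
noncomputable def thetaFac (p q x : ℂ) (n : ℕ) : ℂ :=
  ∏ k ∈ Finset.range n, modTheta p (x * q ^ k)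

/-- The very-well-poised elliptic hypergeometric series
`V(a₁; c₁, …, c_m; q, p)` (with `m = s - 4` for the series written `_{s+1}V_s`, and with the
argument equal to `1`, as always when it is suppressed from the notation), the sum over `k ≥ 0` of
`θ(a₁ q ^ (2k)) / θ(a₁) * (a₁, c₁, …, c_m)_k / (q, a₁ q / c₁, …, a₁ q / c_m)_k * q ^ k`.
It is used for terminating series only, where one of the `c_i` is `q ^ (-n)`. -/
noncomputable def ellipticV (p q a₁ : ℂ) (c : List ℂ) : ℂ :=
  ∑' k : ℕ, modTheta p (a₁ * q ^ (2 * k)) / modTheta p a₁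
    * ((thetaFac p q a₁ k * (c.map fun x => thetaFac p q x k).prod)
      / (thetaFac p q q k * (c.map fun x => thetaFac p q (a₁ * q / x) k).prod))
    * q ^ k

/-! The identity is Lagrange interpolation in disguise. For fixed `p` there are functions `A`, `B`
with θ(xy)θ(x/y) = x(A(x)B(y) − B(x)A(y)) (`exists_modTheta_mul_modTheta`). Hence ∏ θ(b_j z)θ(b_j/z)
is a product of n linear forms in the homogeneous coordinates (A(z), B(z)), and such a form of
degree n is determined by its values at n + 1 distinct points (`homogeneous_lagrange`). The nodes
are z = a q^k, 0 ≤ k ≤ n. Rewriting the Lagrange coefficients as theta shifted factorials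
(`interpolation_coefficient`) gives the sum over k.

The functions `A`, `B` are the odd and even parts of the theta series, so the rank-two formula rests
on the Jacobi triple product, as does the inversion θ(1/x) = −θ(x)/x, which reflects the factors
θ(q^(i−k)).

Distinctness of the nodes involves values θ(a²q^j) that the hypotheses do not control. The identity
is therefore first proved for generic a and then extended by continuity, since the zeros of θ(w²q^j)
in w are isolated.

The ₁₂V₁₁ evaluation takes for the b_j the two geometric strings starting at b and d. -/

open Filter Topology

/-! ### The theta product: convergence, holomorphy, zeros -/

/-- The `j`-th factor of the theta product is `1 + thetaTerm p x j`. -/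
noncomputable def thetaTerm (p x : ℂ) (j : ℕ) : ℂ :=
  -(p ^ j * x) - p ^ (j + 1) / x + p ^ j * p ^ (j + 1)

lemma one_add_thetaTerm {p x : ℂ} (hx : x ≠ 0) (j : ℕ) :
    1 + thetaTerm p x j = (1 - p ^ j * x) * (1 - p ^ (j + 1) / x) := by
  unfold thetaTerm
  field_simp
  ring

lemma norm_thetaTerm_le {p x : ℂ} (hp : ‖p‖ < 1) (j : ℕ) :
    ‖thetaTerm p x j‖ ≤ ‖p‖ ^ j * (‖x‖ + ‖x‖⁻¹ + 1) := by
  have h0 : 0 ≤ ‖p‖ ^ j := by positivity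
  have h1 : ‖p‖ ^ (j + 1) ≤ ‖p‖ ^ j := pow_le_pow_of_le_one (norm_nonneg _) hp.le (Nat.le_succ j)
  have h2 : ‖p‖ ^ (j + 1) ≤ 1 := pow_le_one₀ (norm_nonneg _) hp.le
  calc ‖thetaTerm p x j‖ ≤ ‖p ^ j * x‖ + ‖p ^ (j + 1) / x‖ + ‖p ^ j * p ^ (j + 1)‖ := by
        unfold thetaTerm
        refine (norm_add_le _ _).trans (add_le_add_left ((norm_sub_le _ _).trans ?_) _)
        rw [norm_neg]
    _ = ‖p‖ ^ j * ‖x‖ + ‖p‖ ^ (j + 1) * ‖x‖⁻¹ + ‖p‖ ^ j * ‖p‖ ^ (j + 1) := by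
        simp [div_eq_mul_inv]
    _ ≤ ‖p‖ ^ j * ‖x‖ + ‖p‖ ^ j * ‖x‖⁻¹ + ‖p‖ ^ j * 1 := by gcongr
    _ = _ := by ring

lemma modTheta_eq_tprod {p x : ℂ} (hx : x ≠ 0) : modTheta p x = ∏' j, (1 + thetaTerm p x j) := by
  simp only [modTheta, one_add_thetaTerm hx]

lemma summable_norm_pow_mul {p : ℂ} (hp : ‖p‖ < 1) (c : ℝ) : Summable fun j : ℕ => ‖p‖ ^ j * c :=
  (summable_geometric_of_lt_one (norm_nonneg _) hp).mul_right c

lemma tendsto_modTheta {p x : ℂ} (hp : ‖p‖ < 1) (hx : x ≠ 0) :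
    Tendsto (fun m : ℕ => ∏ j ∈ Finset.range m, ((1 - p ^ j * x) * (1 - p ^ (j + 1) / x))) atTop
      (𝓝 (modTheta p x)) := by
  rw [modTheta_eq_tprod hx]
  simp only [← one_add_thetaTerm hx]
  refine (multipliable_one_add_of_summable ?_).hasProd.tendsto_prod_nat
  exact (summable_norm_pow_mul hp _).of_nonneg_of_le (fun _ => norm_nonneg _)
    (norm_thetaTerm_le hp)

/-- On the annulus ‖x‖/2 < ‖y‖ < 2‖x‖ the terms are dominated by one geometric series, so the
product converges locally uniformly and its limit is holomorphic. -/
lemma differentiableAt_modTheta {p x : ℂ} (hp : ‖p‖ < 1) (hx : x ≠ 0) :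
    DifferentiableAt ℂ (modTheta p) x := by
  set U : Set ℂ := {y | ‖y‖ < 2 * ‖x‖} ∩ {y | ‖x‖ / 2 < ‖y‖} with hU
  have hx' : 0 < ‖x‖ := norm_pos_iff.2 hx
  have hUo : IsOpen U := (isOpen_lt continuous_norm continuous_const).inter
    (isOpen_lt continuous_const continuous_norm)
  have hxU : x ∈ U := ⟨by simp only [Set.mem_ofPred_eq]; linarith,
    by simp only [Set.mem_ofPred_eq]; linarith⟩
  have hU0 : ∀ y ∈ U, y ≠ 0 := fun y hy => norm_pos_iff.1 (lt_trans (by positivity) hy.2)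
  have hd : ∀ j, DifferentiableOn ℂ (fun y => thetaTerm p y j) U := by
    intro j y hy
    have := hU0 y hy
    unfold thetaTerm
    apply DifferentiableAt.differentiableWithinAt
    fun_prop (disch := assumption)
  have key : HasProdLocallyUniformlyOn (fun j y => 1 + thetaTerm p y j)
      (fun y => ∏' j, (1 + thetaTerm p y j)) U := by
    refine Summable.hasProdLocallyUniformlyOn_nat_one_add hUo
      (summable_norm_pow_mul hp (2 * ‖x‖ + (‖x‖ / 2)⁻¹ + 1)) (Eventually.of_forall ?_)
      fun j => (hd j).continuousOn
    intro j y hy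
    refine (norm_thetaTerm_le hp j).trans ?_
    have h1 : ‖y‖ ≤ 2 * ‖x‖ := (show ‖y‖ < 2 * ‖x‖ from hy.1).le
    have h2 : ‖y‖⁻¹ ≤ (‖x‖ / 2)⁻¹ := inv_anti₀ (by positivity) hy.2.le
    gcongr
  have hdiff := key.tendstoLocallyUniformlyOn_finsetRange.differentiableOn
    (Eventually.of_forall fun m => by
      refine DifferentiableOn.fun_finsetProd fun j _ => (hd j).const_add 1) hUo
  refine (hdiff.differentiableAt (hUo.mem_nhds hxU)).congr_of_eventuallyEq ?_
  filter_upwards [hUo.mem_nhds hxU] with y hy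
  exact modTheta_eq_tprod (hU0 y hy)

lemma modTheta_zero_left {x : ℂ} : modTheta 0 x = 1 - x := by
  unfold modTheta
  rw [tprod_eq_mulSingle 0]
  · simp
  · intro j hj
    simp [hj]

lemma modTheta_one_right (p : ℂ) : modTheta p 1 = 0 := by
  unfold modTheta
  exact tprod_of_exists_eq_zero ⟨0, by simp⟩

lemma continuousAt_modTheta_comp {p : ℂ} (hp : ‖p‖ < 1) {f : ℂ → ℂ} {a : ℂ}
    (hf : ContinuousAt f a) (h0 : f a ≠ 0) : ContinuousAt (fun x => modTheta p (f x)) a :=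
  ContinuousAt.comp (g := modTheta p) (differentiableAt_modTheta hp h0).continuousAt hf

lemma continuousAt_thetaFac_comp {p q : ℂ} (hp : ‖p‖ < 1) (hq : q ≠ 0) {f : ℂ → ℂ} {a : ℂ}
    (hf : ContinuousAt f a) (h0 : f a ≠ 0) (n : ℕ) :
    ContinuousAt (fun x => thetaFac p q (f x) n) a := by
  unfold thetaFac
  refine tendsto_finsetProd _ fun k _ => ?_
  exact continuousAt_modTheta_comp hp (hf.mul continuousAt_const) (mul_ne_zero h0 (pow_ne_zero _ hq))

/-- The zeros of `w ↦ θ(w² c)` are isolated. -/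
lemma eventually_modTheta_sq_mul_ne_zero {p a c : ℂ} (hp : ‖p‖ < 1) (ha : a ≠ 0) (hc : c ≠ 0)
    (h : modTheta p (a ^ 2) ≠ 0) : ∀ᶠ w in 𝓝[≠] a, modTheta p (w ^ 2 * c) ≠ 0 := by
  have hd : DifferentiableOn ℂ (fun w => modTheta p (w ^ 2 * c)) {0}ᶜ := by
    intro w hw
    have hw' : w ^ 2 * c ≠ 0 := mul_ne_zero (pow_ne_zero _ hw) hc
    exact (DifferentiableAt.comp (g := modTheta p) w (differentiableAt_modTheta hp hw')
      (by fun_prop)).differentiableWithinAt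
  have han := hd.analyticOnNhd isOpen_compl_singleton
  -- If the function vanished near a, it would vanish on the connected set ℂ ∖ {0}, in particular at
  -- a/r with r² = c, where its value is θ(a²) ≠ 0.
  rcases (han a ha).eventually_eq_zero_or_eventually_ne_zero with h0 | h0
  · exfalso
    obtain ⟨r, hr⟩ := IsAlgClosed.exists_pow_nat_eq c (n := 2) two_pos
    have hr0 : r ≠ 0 := by
      rintro rfl
      exact hc (by simpa using hr.symm)
    have hpre : IsPreconnected ({0}ᶜ : Set ℂ) :=
      (isConnected_compl_singleton_of_one_lt_rank (by simp) 0).isPreconnected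
    have := han.eqOn_zero_of_preconnected_of_eventuallyEq_zero hpre ha h0
      (show a / r ∈ ({0}ᶜ : Set ℂ) from div_ne_zero ha hr0)
    simp only [Pi.zero_apply] at this
    refine h ?_
    rw [← this, ← hr]
    congr 1
    field_simp
  · exact h0

/-! ### The Jacobi triple product -/

lemma HasSum.of_eq {ι : Type*} {f g : ι → ℂ} {a b : ℂ} (h : HasSum f a) (hfg : ∀ k, g k = f k)
    (hab : b = a) : HasSum g b := by
  subst hab
  exact (funext hfg : g = f) ▸ h

/-- The finite product `(p; p)_m`. -/
noncomputable def pochP (p : ℂ) (m : ℕ) : ℂ := ∏ l ∈ Finset.range m, (1 - p ^ (l + 1))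

/-- The reciprocal of `(p; p)_i`, extended by `0` to negative `i`. -/
noncomputable def invPochP (p : ℂ) (i : ℤ) : ℂ := if 0 ≤ i then (pochP p i.toNat)⁻¹ else 0

lemma one_sub_pow_succ_ne_zero {p : ℂ} (hp : ‖p‖ < 1) (l : ℕ) : 1 - p ^ (l + 1) ≠ 0 := by
  intro h
  have h1 : ‖p ^ (l + 1)‖ < 1 := by
    rw [norm_pow]
    exact pow_lt_one₀ (norm_nonneg _) hp (Nat.succ_ne_zero l)
  rw [← sub_eq_zero.1 h] at h1
  simp at h1

lemma pochP_ne_zero {p : ℂ} (hp : ‖p‖ < 1) (m : ℕ) : pochP p m ≠ 0 :=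
  Finset.prod_ne_zero_iff.2 fun l _ => one_sub_pow_succ_ne_zero hp l

/-- Extension by zero makes the recurrence valid for every integer: at i = 0 the factor 1 − p^0
vanishes. This spares all boundary cases in the finite triple product. -/
lemma invPochP_sub_one {p : ℂ} (hp : ‖p‖ < 1) (i : ℤ) :
    invPochP p (i - 1) = (1 - p ^ i) * invPochP p i := by
  rcases lt_trichotomy i 0 with h | rfl | h
  · simp [invPochP, show ¬ (0 ≤ i) by omega, show ¬ (1 ≤ i) by omega]
  · simp [invPochP]
  · obtain ⟨m, rfl⟩ : ∃ m : ℕ, i = m + 1 := ⟨(i - 1).toNat, by omega⟩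
    have h1 := pochP_ne_zero hp m
    have h2 := one_sub_pow_succ_ne_zero hp m
    have h3 : (p : ℂ) ^ ((m : ℤ) + 1) = p ^ (m + 1) := by exact_mod_cast zpow_natCast p (m + 1)
    have h4 : pochP p (m + 1) = pochP p m * (1 - p ^ (m + 1)) := Finset.prod_range_succ _ _
    have h5 : ((m : ℤ) + 1).toNat = m + 1 := by omega
    have h6 : (m : ℤ) + 1 - 1 = m := by ring
    rw [invPochP, invPochP, if_pos (by omega), if_pos (by omega), h5, h6, h3, h4, Int.toNat_natCast]
    field_simp

/-- The coefficient `(-1)^k p^(k(k-1)/2) x^k` of the theta series. -/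
noncomputable def thetaCoeff (p x : ℂ) (k : ℤ) : ℂ :=
  (-1) ^ k * p ^ (k * (k - 1) / 2) * x ^ k

lemma two_mul_choose (k : ℤ) : 2 * (k * (k - 1) / 2) = k * (k - 1) := by
  refine Int.mul_ediv_cancel' ?_
  simpa [mul_comm] using (Int.even_mul_pred_self k).two_dvd

lemma thetaCoeff_sub_one {p x : ℂ} (hp : p ≠ 0) (hx : x ≠ 0) (k : ℤ) :
    thetaCoeff p x k = - (p ^ (k - 1) * x) * thetaCoeff p x (k - 1) := by
  have h : k * (k - 1) / 2 = (k - 1) + (k - 1) * (k - 1 - 1) / 2 := by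
    have h1 := two_mul_choose k
    have h2 := two_mul_choose (k - 1)
    linarith
  unfold thetaCoeff
  rw [h, zpow_add₀ hp]
  conv_lhs => rw [show k = 1 + (k - 1) by ring, zpow_add₀ (by norm_num), zpow_add₀ hx]
  simp
  ring

lemma mul_thetaCoeff_sub_one {p x : ℂ} (hp : p ≠ 0) (hx : x ≠ 0) (k : ℤ) :
    x * thetaCoeff p x (k - 1) = - p ^ (1 - k) * thetaCoeff p x k := by
  have h : p ^ (1 - k) * p ^ (k - 1) = 1 := by
    rw [← zpow_add₀ hp]
    simp
  rw [thetaCoeff_sub_one hp hx k]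
  linear_combination - x * thetaCoeff p x (k - 1) * h

lemma thetaCoeff_add_one_div {p x : ℂ} (hp : p ≠ 0) (hx : x ≠ 0) (k : ℤ) :
    thetaCoeff p x (k + 1) / x = - p ^ k * thetaCoeff p x k := by
  rw [thetaCoeff_sub_one hp hx (k + 1), add_sub_cancel_right]
  field_simp

/-- The finite form of the Jacobi triple product. -/
lemma hasSum_finite_triple_product {p x : ℂ} (hp0 : p ≠ 0) (hp : ‖p‖ < 1) (hx : x ≠ 0) (m : ℕ) :
    HasSum (fun k : ℤ => pochP p (2 * m) * invPochP p (m + k) * invPochP p (m - k)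
        * thetaCoeff p x k)
      (∏ j ∈ Finset.range m, ((1 - p ^ j * x) * (1 - p ^ (j + 1) / x))) := by
  induction m with
  | zero =>
    have := hasSum_single (f := fun k : ℤ => pochP p (2 * 0) * invPochP p ((0 : ℕ) + k)
        * invPochP p ((0 : ℕ) - k) * thetaCoeff p x k) 0 (by
      intro k hk
      rcases lt_or_gt_of_ne hk with h | h
      · simp [invPochP, show ¬ (0 ≤ k) by omega]
      · simp [invPochP, show ¬ (k ≤ 0) by omega])
    simpa [pochP, invPochP, thetaCoeff] using this
  | succ m ih =>
    have hPs : ∀ N, pochP p (N + 1) = pochP p N * (1 - p ^ (N + 1)) :=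
      fun N => Finset.prod_range_succ _ _
    -- The new factor is multiplied in two halves, first 1 − p^m x and then 1 − p^(m+1)/x. Each half
    -- is a q-Pascal rule: with v, w the two powers of p below, the coefficients combine by (1 − v)
    -- + v(1 − w) = 1 − vw, or the same with v and w exchanged.
    have hstep : HasSum (fun k : ℤ => pochP p (2 * m + 1) * invPochP p (m + k)
        * invPochP p (m + 1 - k) * thetaCoeff p x k)
        ((∏ j ∈ Finset.range m, ((1 - p ^ j * x) * (1 - p ^ (j + 1) / x))) * (1 - p ^ m * x)) := by
      have h2 := ((Equiv.subRight (1 : ℤ)).hasSum_iff.2 ih).mul_left (p ^ m * x)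
      refine (ih.sub h2).of_eq (fun k => ?_) ?_
      · have e1 := invPochP_sub_one hp (m + k)
        have e2 := invPochP_sub_one hp (m + 1 - k)
        have e3 := mul_thetaCoeff_sub_one hp0 hx k
        have e4 : p ^ ((m : ℤ) + 1 - k) = p ^ m * p ^ (1 - k) := by
          rw [← zpow_natCast, ← zpow_add₀ hp0]
          ring_nf
        have e5 : p ^ ((m : ℤ) + 1 - k) * p ^ ((m : ℤ) + k) = p ^ (2 * m + 1) := by
          rw [← zpow_natCast, ← zpow_add₀ hp0]
          push_cast
          ring_nf
        rw [show (m : ℤ) + 1 - k - 1 = m - k by ring] at e2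
        simp only [Function.comp_apply, Equiv.subRight_apply]
        rw [show (m : ℤ) + (k - 1) = m + k - 1 by ring,
          show (m : ℤ) - (k - 1) = m + 1 - k by ring, e1, e2, hPs]
        generalize p ^ ((m : ℤ) + 1 - k) = v at *
        generalize p ^ ((m : ℤ) + k) = w at *
        generalize pochP p (2 * m) = P at *
        generalize invPochP p ((m : ℤ) + k) = R at *
        generalize invPochP p ((m : ℤ) + 1 - k) = S at *
        linear_combination P * R * S * (1 - w) * p ^ m * e3
          + P * R * S * thetaCoeff p x k * e5 + P * R * S * (1 - w) * thetaCoeff p x k * e4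
      · ring
    have h2 := ((Equiv.addRight (1 : ℤ)).hasSum_iff.2 hstep).mul_left (p ^ (m + 1) / x)
    refine (hstep.sub h2).of_eq (fun k => ?_) ?_
    · have e1 := invPochP_sub_one hp (m + 1 + k)
      have e2 := invPochP_sub_one hp (m + 1 - k)
      have e3 := thetaCoeff_add_one_div hp0 hx k
      have e4 : p ^ ((m : ℤ) + 1 + k) = p ^ (m + 1) * p ^ k := by
        rw [← zpow_natCast, ← zpow_add₀ hp0]
        push_cast
        ring_nf
      have e5 : p ^ ((m : ℤ) + 1 - k) * p ^ ((m : ℤ) + 1 + k) = p ^ (2 * m + 1 + 1) := by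
        rw [← zpow_natCast, ← zpow_add₀ hp0]
        push_cast
        ring_nf
      rw [show (m : ℤ) + 1 - k - 1 = m - k by ring] at e2
      rw [show (m : ℤ) + 1 + k - 1 = m + k by ring] at e1
      simp only [Function.comp_apply, Equiv.coe_addRight]
      rw [show 2 * (m + 1) = 2 * m + 1 + 1 by ring, hPs (2 * m + 1), Nat.cast_add, Nat.cast_one,
        show (m : ℤ) + (k + 1) = m + 1 + k by ring,
        show (m : ℤ) + 1 - (k + 1) = m - k by ring, e1, e2]
      generalize p ^ ((m : ℤ) + 1 - k) = v at *
      generalize p ^ ((m : ℤ) + 1 + k) = w at *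
      generalize pochP p (2 * m + 1) = P at *
      generalize invPochP p ((m : ℤ) + 1 + k) = R at *
      generalize invPochP p ((m : ℤ) + 1 - k) = S at *
      linear_combination P * R * S * (1 - v) * p ^ (m + 1) * e3
        + P * R * S * thetaCoeff p x k * e5 + P * R * S * (1 - v) * thetaCoeff p x k * e4
    · rw [Finset.prod_range_succ]
      ring

lemma tendsto_pochP {p : ℂ} (hp : ‖p‖ < 1) :
    ∃ C : ℂ, C ≠ 0 ∧ Tendsto (pochP p) atTop (𝓝 C) := by
  have hs : Summable fun l : ℕ => ‖-p ^ (l + 1)‖ := by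
    simp only [norm_neg, norm_pow]
    exact (summable_nat_add_iff 1).2 (summable_geometric_of_lt_one (norm_nonneg _) hp)
  refine ⟨∏' l : ℕ, (1 + -p ^ (l + 1)), tprod_one_add_ne_zero_of_summable (fun l => ?_) hs, ?_⟩
  · simpa [sub_eq_add_neg] using one_sub_pow_succ_ne_zero hp l
  · have := (multipliable_one_add_of_summable hs).hasProd.tendsto_prod_nat
    simp only [← sub_eq_add_neg] at this ⊢
    exact this

/-- Ratio test: the quotient of consecutive terms has norm ‖p‖^n ‖y‖, which tends to 0. -/
lemma summable_norm_pow_choose_mul_pow {p : ℂ} (hp : ‖p‖ < 1) (y : ℂ) :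
    Summable fun n : ℕ => ‖p ^ ((n : ℤ) * (n - 1) / 2) * y ^ n‖ := by
  refine summable_of_ratio_norm_eventually_le (r := 1 / 2) (by norm_num) ?_
  have h0 : Tendsto (fun n : ℕ => ‖p‖ ^ n * ‖y‖) atTop (𝓝 0) := by
    simpa using (tendsto_pow_atTop_nhds_zero_of_lt_one (norm_nonneg p) hp).mul_const ‖y‖
  filter_upwards [h0.eventually_le_const (show (0 : ℝ) < 1 / 2 by norm_num)] with n hn
  have h1 : ((n + 1 : ℕ) : ℤ) * (((n + 1 : ℕ) : ℤ) - 1) / 2 = ((n * (n - 1) / 2 : ℕ) + n : ℕ) := by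
    have h2 := two_mul_choose ((n + 1 : ℕ) : ℤ)
    have h3 : 2 * (n * (n - 1) / 2) = n * (n - 1) :=
      Nat.mul_div_cancel' (Nat.even_mul_pred_self n).two_dvd
    have h4 : ((n * (n - 1) : ℕ) : ℤ) = n * (n - 1) := by cases n <;> simp
    rw [← h3] at h4
    push_cast at h2 h4 ⊢
    linarith
  have h1' : (n : ℤ) * ((n : ℤ) - 1) / 2 = ((n * (n - 1) / 2 : ℕ) : ℤ) := by cases n <;> simp
  rw [h1, h1', zpow_natCast, zpow_natCast, pow_add, pow_succ]
  simp only [norm_norm, norm_mul, norm_pow]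
  calc _ = (‖p‖ ^ n * ‖y‖) * (‖p‖ ^ (n * (n - 1) / 2) * ‖y‖ ^ n) := by ring
    _ ≤ _ := by gcongr

lemma summable_norm_thetaCoeff {p x : ℂ} (hp0 : p ≠ 0) (hp : ‖p‖ < 1) :
    Summable fun k : ℤ => ‖thetaCoeff p x k‖ := by
  refine Summable.of_nat_of_neg ?_ ?_
  · refine (summable_norm_pow_choose_mul_pow hp x).congr fun n => ?_
    simp [thetaCoeff]
  -- At k = −n the exponent k(k − 1)/2 equals n(n − 1)/2 + n; the extra p^n turns x⁻¹ into p/x.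
  · refine (summable_norm_pow_choose_mul_pow hp (p / x)).congr fun n => ?_
    have h : -(n : ℤ) * (-(n : ℤ) - 1) / 2 = (n : ℤ) * (n - 1) / 2 + n := by
      have h1 := two_mul_choose (n : ℤ)
      have h2 := two_mul_choose (-(n : ℤ))
      linarith
    rw [thetaCoeff, h, zpow_add₀ hp0]
    simp [div_eq_mul_inv, mul_pow]
    ring

/-- The Jacobi triple product, up to the value of the constant. -/
lemma jacobi_triple_product {p : ℂ} (hp0 : p ≠ 0) (hp : ‖p‖ < 1) :
    ∃ C : ℂ, ∀ x, x ≠ 0 → HasSum (fun k => C * thetaCoeff p x k) (modTheta p x) := by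
  obtain ⟨C, hC, hlim⟩ := tendsto_pochP hp
  refine ⟨C⁻¹, fun x hx => ?_⟩
  obtain ⟨M, hM⟩ := (Metric.isBounded_range_of_tendsto _ hlim).exists_norm_le
  obtain ⟨M', hM'⟩ := (Metric.isBounded_range_of_tendsto _ (hlim.inv₀ hC)).exists_norm_le
  simp only [Set.mem_range, forall_exists_index, forall_apply_eq_imp_iff] at hM hM'
  have hM'0 : 0 ≤ M' := (norm_nonneg _).trans (hM' 0)
  have hR : ∀ i, ‖invPochP p i‖ ≤ M' := by
    intro i
    unfold invPochP
    split_ifs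
    · exact hM' _
    · simpa using hM'0
  have htoNat : Tendsto Int.toNat atTop atTop := by
    refine tendsto_atTop.2 fun b => ?_
    filter_upwards [eventually_ge_atTop (b : ℤ)] with i hi
    omega
  have hRlim : Tendsto (invPochP p) atTop (𝓝 C⁻¹) := by
    refine ((hlim.inv₀ hC).comp htoNat).congr' ?_
    filter_upwards [eventually_ge_atTop 0] with i hi
    simp [invPochP, hi]
  have hsum := summable_norm_thetaCoeff (x := x) hp0 hp
  -- Tannery's theorem, m → ∞ in the finite form: the three Pochhammer factors tend to C · C⁻¹ · C⁻¹
  -- = C⁻¹ and are bounded by M, M', M'.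
  have hT := tendsto_tsum_of_dominated_convergence (𝓕 := atTop)
    (f := fun (m : ℕ) (k : ℤ) => pochP p (2 * m) * invPochP p (m + k) * invPochP p (m - k)
        * thetaCoeff p x k) (g := fun k => C⁻¹ * thetaCoeff p x k)
    (bound := fun k => M * M' * M' * ‖thetaCoeff p x k‖) (hsum.mul_left _) (fun k => ?_)
    (Eventually.of_forall fun m k => ?_)
  · simp only [(hasSum_finite_triple_product hp0 hp hx _).tsum_eq] at hT
    rw [tendsto_nhds_unique (tendsto_modTheta hp hx) hT]
    exact (hsum.of_norm.mul_left C⁻¹).hasSum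
  · have h1 : Tendsto (fun m : ℕ => pochP p (2 * m)) atTop (𝓝 C) :=
      hlim.comp (tendsto_id.const_mul_atTop' two_pos)
    have h2 : Tendsto (fun m : ℕ => invPochP p (m + k)) atTop (𝓝 C⁻¹) :=
      hRlim.comp (tendsto_atTop_add_const_right _ _ tendsto_natCast_atTop_atTop)
    have h3 : Tendsto (fun m : ℕ => invPochP p (m - k)) atTop (𝓝 C⁻¹) :=
      hRlim.comp (tendsto_atTop_add_const_right _ (-k) tendsto_natCast_atTop_atTop)
    have := ((h1.mul h2).mul h3).mul_const (thetaCoeff p x k)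
    rwa [mul_inv_cancel₀ hC, one_mul] at this
  · rw [norm_mul, norm_mul, norm_mul]
    have h1 := hM (2 * m)
    have h2 := hR (m + k)
    have h3 := hR (m - k)
    have hM0 : 0 ≤ M := (norm_nonneg _).trans (hM 0)
    gcongr

/-! ### The inversion formula -/

/-- The exponent k(k − 1)/2 is invariant under k ↦ 1 − k, whereas the sign (−1)^k changes. -/
lemma thetaCoeff_inv (p : ℂ) {x : ℂ} (hx : x ≠ 0) (k : ℤ) :
    thetaCoeff p (1 / x) (1 - k) = - (1 / x) * thetaCoeff p x k := by
  have h : (1 - k) * (1 - k - 1) / 2 = k * (k - 1) / 2 := by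
    congr 1
    ring
  have h1 : (-1 : ℂ) ^ (1 - k) = - (-1) ^ k := by
    rw [zpow_sub₀ (by norm_num), zpow_one]
    rcases Int.even_or_odd k with hk | hk
    · simp [hk.neg_one_zpow]
    · simp [hk.neg_one_zpow]
  have h2 : (1 / x) ^ (1 - k) = 1 / x * x ^ k := by
    rw [zpow_sub₀ (by simpa using hx), zpow_one]
    simp
  rw [thetaCoeff, thetaCoeff, h, h1, h2]
  ring

/-- The inversion formula `θ(1/x) = -θ(x)/x`. -/
lemma modTheta_one_div {p x : ℂ} (hp : ‖p‖ < 1) (hx : x ≠ 0) :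
    modTheta p (1 / x) = - (1 / x) * modTheta p x := by
  rcases eq_or_ne p 0 with rfl | hp0
  · rw [modTheta_zero_left, modTheta_zero_left]
    field_simp
    ring
  · obtain ⟨C, hC⟩ := jacobi_triple_product hp0 hp
    have h1 := (Equiv.subLeft (1 : ℤ)).hasSum_iff.2 (hC (1 / x) (by simpa using hx))
    have h2 := (hC x hx).mul_left (-(1 / x))
    refine h1.unique (h2.of_eq (fun k => ?_) rfl)
    simp only [Function.comp_apply, Equiv.subLeft_apply, thetaCoeff_inv p hx]
    ring

/-! ### The rank-two formula for θ(xy)θ(x/y) -/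

/-- Pairs of integers, sorted by the parity of their sum. -/
def intParityEquiv : (ℤ × ℤ) ⊕ (ℤ × ℤ) ≃ ℤ × ℤ where
  toFun := Sum.elim (fun u => (u.1 + u.2, u.1 - u.2)) (fun u => (u.1 + u.2 + 1, u.1 - u.2))
  invFun u := if (u.1 + u.2) % 2 = 0 then .inl ((u.1 + u.2) / 2, (u.1 - u.2) / 2)
    else .inr ((u.1 + u.2 - 1) / 2, (u.1 - u.2 - 1) / 2)
  left_inv := by
    rintro (⟨k, l⟩ | ⟨k, l⟩)
    · have h : (k + l + (k - l)) % 2 = 0 := by omega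
      simp only [Sum.elim_inl, h, if_true, Sum.inl.injEq, Prod.mk.injEq]
      omega
    · have h : ¬ (k + l + 1 + (k - l)) % 2 = 0 := by omega
      simp only [Sum.elim_inr, h, if_false, Sum.inr.injEq, Prod.mk.injEq]
      omega
  right_inv := by
    rintro ⟨m, n⟩
    simp only
    split_ifs with h
    · simp only [Sum.elim_inl, Prod.mk.injEq]
      omega
    · simp only [Sum.elim_inr, Prod.mk.injEq]
      omega

lemma zpow_neg_one_two_mul (k : ℤ) : (-1 : ℂ) ^ (2 * k) = 1 := (even_two_mul k).neg_one_zpow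

lemma mul_zpow_mul_div_zpow {x y : ℂ} (hx : x ≠ 0) (hy : y ≠ 0) (m n : ℤ) :
    (x * y) ^ m * (x / y) ^ n = x ^ (m + n) * y ^ (m - n) := by
  rw [mul_zpow, div_zpow, zpow_add₀ hx, zpow_sub₀ hy]
  ring

/-- The exponents at k + l and k − l add up to k² − k + l², without a mixed term, so the variables x
and y separate. -/
lemma thetaCoeff_mul_even {p x y : ℂ} (hp : p ≠ 0) (hx : x ≠ 0) (hy : y ≠ 0) (k l : ℤ) :
    thetaCoeff p (x * y) (k + l) * thetaCoeff p (x / y) (k - l)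
      = (p ^ (k ^ 2 - k) * x ^ (2 * k)) * (p ^ l ^ 2 * y ^ (2 * l)) := by
  have h1 := two_mul_choose (k + l)
  have h2 := two_mul_choose (k - l)
  have h3 : (k + l) * (k + l - 1) / 2 + (k - l) * (k - l - 1) / 2 = k ^ 2 - k + l ^ 2 := by
    linarith
  have h4 : (-1 : ℂ) ^ (k + l) * (-1) ^ (k - l) = 1 := by
    rw [← zpow_add₀ (by norm_num), show k + l + (k - l) = 2 * k by ring, zpow_neg_one_two_mul]
  have h5 : (x * y) ^ (k + l) * (x / y) ^ (k - l) = x ^ (2 * k) * y ^ (2 * l) := by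
    rw [mul_zpow_mul_div_zpow hx hy]
    ring_nf
  calc _ = ((-1 : ℂ) ^ (k + l) * (-1) ^ (k - l))
        * (p ^ ((k + l) * (k + l - 1) / 2) * p ^ ((k - l) * (k - l - 1) / 2))
        * ((x * y) ^ (k + l) * (x / y) ^ (k - l)) := by unfold thetaCoeff; ring
    _ = _ := by
      rw [h4, h5, ← zpow_add₀ hp, h3, zpow_add₀ hp]
      ring

/-- Again the mixed terms cancel; the sign −1 is the source of the antisymmetry in the rank-two
formula. -/
lemma thetaCoeff_mul_odd {p x y : ℂ} (hp : p ≠ 0) (hx : x ≠ 0) (hy : y ≠ 0) (k l : ℤ) :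
    thetaCoeff p (x * y) (k + l + 1) * thetaCoeff p (x / y) (k - l)
      = (-(p ^ k ^ 2 * x ^ (2 * k + 1))) * (p ^ (l ^ 2 + l) * y ^ (2 * l + 1)) := by
  have h1 := two_mul_choose (k + l + 1)
  have h2 := two_mul_choose (k - l)
  have h3 : (k + l + 1) * (k + l + 1 - 1) / 2 + (k - l) * (k - l - 1) / 2
      = k ^ 2 + (l ^ 2 + l) := by
    linarith
  have h4 : (-1 : ℂ) ^ (k + l + 1) * (-1) ^ (k - l) = -1 := by
    rw [← zpow_add₀ (by norm_num), show k + l + 1 + (k - l) = 2 * k + 1 by ring,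
      zpow_add₀ (by norm_num), zpow_neg_one_two_mul]
    norm_num
  have h5 : (x * y) ^ (k + l + 1) * (x / y) ^ (k - l) = x ^ (2 * k + 1) * y ^ (2 * l + 1) := by
    rw [mul_zpow_mul_div_zpow hx hy]
    ring_nf
  calc _ = ((-1 : ℂ) ^ (k + l + 1) * (-1) ^ (k - l))
        * (p ^ ((k + l + 1) * (k + l + 1 - 1) / 2) * p ^ ((k - l) * (k - l - 1) / 2))
        * ((x * y) ^ (k + l + 1) * (x / y) ^ (k - l)) := by unfold thetaCoeff; ring
    _ = _ := by
      rw [h4, h5, ← zpow_add₀ hp, h3, zpow_add₀ hp]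
      ring

/-- The terms of the even part of the theta series. -/
noncomputable def thetaEven (p y : ℂ) (l : ℤ) : ℂ := p ^ l ^ 2 * y ^ (2 * l)

/-- The terms of the odd part of the theta series. -/
noncomputable def thetaOdd (p y : ℂ) (l : ℤ) : ℂ := p ^ (l ^ 2 + l) * y ^ (2 * l + 1)

lemma sq_zpow_choose_mul_zpow {p : ℂ} (hp0 : p ≠ 0) (l : ℤ) :
    (p ^ 2) ^ (l * (l - 1) / 2) * p ^ l = p ^ l ^ 2 := by
  rw [← zpow_natCast, ← zpow_mul, ← zpow_add₀ hp0]
  congr 1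
  have := two_mul_choose l
  push_cast
  linarith

/-- Up to signs this is a theta series with p² in place of p, so summability is inherited. -/
lemma thetaEven_eq {p : ℂ} (hp0 : p ≠ 0) (y : ℂ) (l : ℤ) :
    thetaEven p y l = (-1) ^ l * thetaCoeff (p ^ 2) (p * y ^ 2) l := by
  have h : (-1 : ℂ) ^ l * (-1) ^ l = 1 := by rw [← mul_zpow]; simp
  have h2 : y ^ (2 * l) = (y ^ 2) ^ l := zpow_mul y 2 l
  rw [thetaEven, thetaCoeff, mul_zpow, ← sq_zpow_choose_mul_zpow hp0, h2]
  linear_combination - (p ^ 2) ^ (l * (l - 1) / 2) * p ^ l * (y ^ 2) ^ l * h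

lemma thetaOdd_eq {p y : ℂ} (hp0 : p ≠ 0) (hy : y ≠ 0) (l : ℤ) :
    thetaOdd p y l = y * (-1) ^ l * thetaCoeff (p ^ 2) (p ^ 2 * y ^ 2) l := by
  have h : (-1 : ℂ) ^ l * (-1) ^ l = 1 := by rw [← mul_zpow]; simp
  have h2 : y ^ (2 * l) = (y ^ 2) ^ l := zpow_mul y 2 l
  have h3 : (p ^ 2) ^ l = p ^ l * p ^ l := by rw [← mul_zpow, sq]
  rw [thetaOdd, thetaCoeff, mul_zpow, zpow_add₀ hp0, ← sq_zpow_choose_mul_zpow hp0,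
    zpow_add_one₀ hy, h2, h3]
  linear_combination - (p ^ 2) ^ (l * (l - 1) / 2) * p ^ l * p ^ l * (y ^ 2) ^ l * y * h

lemma norm_sq_lt_one {p : ℂ} (hp : ‖p‖ < 1) : ‖p ^ 2‖ < 1 := by
  rw [norm_pow]
  exact pow_lt_one₀ (norm_nonneg _) hp two_ne_zero

lemma summable_norm_thetaEven {p : ℂ} (hp0 : p ≠ 0) (hp : ‖p‖ < 1) (y : ℂ) :
    Summable fun l => ‖thetaEven p y l‖ := by
  refine (summable_norm_thetaCoeff (x := p * y ^ 2) (pow_ne_zero 2 hp0)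
    (norm_sq_lt_one hp)).congr fun l => ?_
  rw [thetaEven_eq hp0, norm_mul, norm_zpow]
  simp

lemma summable_norm_thetaOdd {p y : ℂ} (hp0 : p ≠ 0) (hp : ‖p‖ < 1) (hy : y ≠ 0) :
    Summable fun l => ‖thetaOdd p y l‖ := by
  refine ((summable_norm_thetaCoeff (x := p ^ 2 * y ^ 2) (pow_ne_zero 2 hp0)
    (norm_sq_lt_one hp)).mul_left ‖y‖).congr fun l => ?_
  rw [thetaOdd_eq hp0 hy, norm_mul, norm_mul, norm_zpow]
  simp

/-- Identifies the x-factor of `thetaCoeff_mul_even` as a shifted odd term, so that the same two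
functions occur in x and in y and a determinant results. -/
lemma mul_thetaOdd_sub_one {x : ℂ} (p : ℂ) (hx : x ≠ 0) (k : ℤ) :
    x * thetaOdd p x (k - 1) = p ^ (k ^ 2 - k) * x ^ (2 * k) := by
  rw [thetaOdd, mul_left_comm, ← zpow_one_add₀ hx]
  ring_nf

lemma hasSum_mul_of_summable_norm {f g : ℤ → ℂ} {a b : ℂ} (hf : HasSum f a) (hg : HasSum g b)
    (hf' : Summable fun k => ‖f k‖) (hg' : Summable fun k => ‖g k‖) :
    HasSum (fun u : ℤ × ℤ => f u.1 * g u.2) (a * b) :=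
  hf.mul hg (summable_mul_of_summable_norm (f := f) (g := g) hf' hg')

lemma hasSum_int_prod_of_parity {F : ℤ → ℤ → ℂ} {a b : ℂ}
    (h1 : HasSum (fun u : ℤ × ℤ => F (u.1 + u.2) (u.1 - u.2)) a)
    (h2 : HasSum (fun u : ℤ × ℤ => F (u.1 + u.2 + 1) (u.1 - u.2)) b) :
    HasSum (fun u : ℤ × ℤ => F u.1 u.2) (a + b) :=
  intParityEquiv.hasSum_iff.1 (HasSum.sum h1 h2)

/-- A product of two theta functions `θ(xy) θ(x/y)` is a determinant of rank two. -/
lemma exists_modTheta_mul_modTheta {p : ℂ} (hp : ‖p‖ < 1) :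
    ∃ A B : ℂ → ℂ, ∀ x y, x ≠ 0 → y ≠ 0 →
      modTheta p (x * y) * modTheta p (x / y) = x * (A x * B y - B x * A y) := by
  rcases eq_or_ne p 0 with rfl | hp0
  -- For p = 0, where the theta series is not available, (1 − xy)(1 − x/y) = x((x + 1/x) − (y +
  -- 1/y)).
  · refine ⟨fun x => x + 1 / x, fun _ => 1, fun x y hx hy => ?_⟩
    rw [modTheta_zero_left, modTheta_zero_left]
    field_simp
    ring
  obtain ⟨C, hC⟩ := jacobi_triple_product hp0 hp
  have hsum : ∀ x, Summable fun k : ℤ => ‖C * thetaCoeff p x k‖ := fun x => by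
    simpa using (summable_norm_thetaCoeff (x := x) hp0 hp).mul_left ‖C‖
  have hE := summable_norm_thetaEven hp0 hp
  have hO := fun y (hy : y ≠ 0) => summable_norm_thetaOdd hp0 hp hy
  -- In the double series of the product, index pairs of even sum contribute x A(x) B(y) and those
  -- of odd sum −x B(x) A(y).
  refine ⟨fun x => C * ∑' l, thetaOdd p x l, fun x => C * ∑' l, thetaEven p x l,
    fun x y hx hy => ?_⟩
  have hev : HasSum (fun u : ℤ × ℤ => C * thetaCoeff p (x * y) (u.1 + u.2)
      * (C * thetaCoeff p (x / y) (u.1 - u.2)))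
      (C ^ 2 * ((x * ∑' l, thetaOdd p x l) * ∑' l, thetaEven p y l)) := by
    have h1 : HasSum (fun k => x * thetaOdd p x (k - 1)) (x * ∑' l, thetaOdd p x l) :=
      ((Equiv.subRight (1 : ℤ)).hasSum_iff.2 (hO x hx).of_norm.hasSum).mul_left x
    have h1' : Summable fun k => ‖x * thetaOdd p x (k - 1)‖ := by
      simpa using ((Equiv.subRight (1 : ℤ)).summable_iff.2 (hO x hx)).mul_left ‖x‖
    refine ((hasSum_mul_of_summable_norm h1 (hE y).of_norm.hasSum h1' (hE y)).mul_left
      (C ^ 2)).of_eq ?_ rfl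
    rintro ⟨k, l⟩
    have h := thetaCoeff_mul_even hp0 hx hy k l
    rw [← mul_thetaOdd_sub_one p hx] at h
    simp only [thetaEven]
    linear_combination C ^ 2 * h
  have hodd : HasSum (fun u : ℤ × ℤ => C * thetaCoeff p (x * y) (u.1 + u.2 + 1)
      * (C * thetaCoeff p (x / y) (u.1 - u.2)))
      (C ^ 2 * (-(x * ∑' l, thetaEven p x l) * ∑' l, thetaOdd p y l)) := by
    have h2 : HasSum (fun k => -(x * thetaEven p x k)) (-(x * ∑' l, thetaEven p x l)) :=
      ((hE x).of_norm.hasSum.mul_left (-x)).of_eq (fun k => by ring) (by ring)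
    have h2' : Summable fun k => ‖-(x * thetaEven p x k)‖ := by
      simpa using (hE x).mul_left ‖x‖
    refine ((hasSum_mul_of_summable_norm h2 (hO y hy).of_norm.hasSum h2' (hO y hy)).mul_left
      (C ^ 2)).of_eq ?_ rfl
    rintro ⟨k, l⟩
    have h := thetaCoeff_mul_odd hp0 hx hy k l
    rw [zpow_add_one₀ hx] at h
    simp only [thetaEven, thetaOdd]
    linear_combination C ^ 2 * h
  have htot := hasSum_mul_of_summable_norm (hC (x * y) (mul_ne_zero hx hy))
    (hC (x / y) (div_ne_zero hx hy)) (hsum _) (hsum _)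
  rw [htot.unique (hasSum_int_prod_of_parity
    (F := fun k l => C * thetaCoeff p (x * y) k * (C * thetaCoeff p (x / y) l)) hev hodd)]
  ring

/-! ### Homogeneous Lagrange interpolation -/

/-- Lagrange interpolation for products of linear forms in homogeneous coordinates: `D` is any
antisymmetric kernel of rank two, such as `D x y = A x * B y - B x * A y`. -/
lemma homogeneous_lagrange {α : Type*} (A B : α → ℂ) (D : α → α → ℂ)
    (hD : ∀ x y, D x y = A x * B y - B x * A y) (x : ℕ → α) (b : ℕ → α) (z : α) (n : ℕ)
    (hx : ∀ i ≤ n, ∀ k ≤ n, i ≠ k → D (x i) (x k) ≠ 0) :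
    ∏ j ∈ Finset.range n, D (b j) z = ∑ k ∈ Finset.range (n + 1),
      (∏ j ∈ Finset.range n, D (b j) (x k)) *
        ∏ i ∈ (Finset.range (n + 1)).erase k, D (x i) z / D (x i) (x k) := by
  induction n generalizing z with
  | zero => simp
  | succ n ih =>
    have ih' := fun z => ih z fun i hi k hk => hx i (by omega) k (by omega)
    set y := x (n + 1) with hy
    have hny : ∀ i ∈ Finset.range (n + 1), D (x i) y ≠ 0 := fun i hi =>
      hx i (by simp at hi; omega) (n + 1) le_rfl (by simp at hi; omega)
    have hny' : ∀ i ∈ Finset.range (n + 1), D y (x i) ≠ 0 := fun i hi =>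
      hx (n + 1) le_rfl i (by simp at hi; omega) (by simp at hi; omega)
    have hlast : (Finset.range (n + 1 + 1)).erase (n + 1) = Finset.range (n + 1) := by
      ext i; simp; omega
    have herase : ∀ k ∈ Finset.range (n + 1),
        ∏ i ∈ (Finset.range (n + 1 + 1)).erase k, D (x i) z / D (x i) (x k)
          = (D y z / D y (x k)) *
            ∏ i ∈ (Finset.range (n + 1)).erase k, D (x i) z / D (x i) (x k) := by
      intro k hk
      have : (Finset.range (n + 1 + 1)).erase k
          = insert (n + 1) ((Finset.range (n + 1)).erase k) := by
        ext i; simp at hk ⊢; omega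
      rw [this, Finset.prod_insert (by simp)]
    -- The three-term Plücker relation: the linear form D(b_n, ·) interpolated at the two nodes x_k
    -- and y.
    have hsplit : ∀ k ∈ Finset.range (n + 1), D (b n) z
        = D (b n) (x k) * (D y z / D y (x k)) + D (b n) y * (D (x k) z / D (x k) y) := by
      intro k hk
      have h1 := hny k hk
      have h2 : D y (x k) = - D (x k) y := by rw [hD, hD]; ring
      rw [h2]
      field_simp
      simp only [hD]
      ring
    rw [Finset.sum_range_succ, hlast, Finset.prod_range_succ, ih' z, Finset.sum_mul]
    -- The first summand is the k-th term of the new formula. Summed over k, the second collapses to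
    -- the term of the new node y, by the induction hypothesis evaluated at y.
    have hterm : ∀ k ∈ Finset.range (n + 1),
        (∏ j ∈ Finset.range n, D (b j) (x k)) *
          (∏ i ∈ (Finset.range (n + 1)).erase k, D (x i) z / D (x i) (x k)) * D (b n) z
        = (∏ j ∈ Finset.range (n + 1), D (b j) (x k)) *
            (∏ i ∈ (Finset.range (n + 1 + 1)).erase k, D (x i) z / D (x i) (x k))
          + D (b n) y * ((∏ i ∈ Finset.range (n + 1), D (x i) z / D (x i) y) *
            ((∏ j ∈ Finset.range n, D (b j) (x k)) *
              ∏ i ∈ (Finset.range (n + 1)).erase k, D (x i) y / D (x i) (x k))) := by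
      intro k hk
      rw [herase k hk, Finset.prod_range_succ]
      have : (∏ i ∈ Finset.range (n + 1), D (x i) z / D (x i) y) *
          ∏ i ∈ (Finset.range (n + 1)).erase k, D (x i) y / D (x i) (x k)
          = (D (x k) z / D (x k) y) *
            ∏ i ∈ (Finset.range (n + 1)).erase k, D (x i) z / D (x i) (x k) := by
        rw [← Finset.mul_prod_erase _ _ hk, mul_assoc, ← Finset.prod_mul_distrib]
        congr 1
        refine Finset.prod_congr rfl fun i hi => ?_
        exact div_mul_div_cancel₀ (hny i (Finset.mem_of_mem_erase hi))
      rw [hsplit k hk]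
      linear_combination (- D (b n) y * ∏ j ∈ Finset.range n, D (b j) (x k)) * this
    rw [Finset.sum_congr rfl hterm, Finset.sum_add_distrib, ← Finset.mul_sum, ← Finset.mul_sum,
      ← ih' y, ← hy,
      Finset.prod_range_succ (fun j => D (b j) y) n]
    ring

/-! ### Theta shifted factorials and the interpolation coefficients -/

lemma thetaFac_add {p q : ℂ} (x : ℂ) (m n : ℕ) :
    thetaFac p q x (m + n) = thetaFac p q x m * thetaFac p q (x * q ^ m) n := by
  unfold thetaFac
  rw [Finset.prod_range_add]
  simp only [pow_add, mul_assoc]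

lemma thetaFac_succ {p q : ℂ} (x : ℂ) (n : ℕ) :
    thetaFac p q x (n + 1) = thetaFac p q x n * modTheta p (x * q ^ n) :=
  Finset.prod_range_succ _ _

lemma thetaFac_succ' {p q : ℂ} (x : ℂ) (n : ℕ) :
    thetaFac p q x (n + 1) = modTheta p x * thetaFac p q (x * q) n := by
  rw [add_comm, thetaFac_add]
  simp [thetaFac]

lemma thetaFac_ne_zero_iff {p q x : ℂ} {n : ℕ} :
    thetaFac p q x n ≠ 0 ↔ ∀ k < n, modTheta p (x * q ^ k) ≠ 0 := by
  simp [thetaFac, Finset.prod_ne_zero_iff]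

lemma thetaFac_ne_zero_of_le {p q x : ℂ} {m n : ℕ} (h : thetaFac p q x n ≠ 0) (hmn : m ≤ n) :
    thetaFac p q x m ≠ 0 :=
  thetaFac_ne_zero_iff.2 fun k hk => thetaFac_ne_zero_iff.1 h k (hk.trans_le hmn)

lemma modTheta_one_div_ne_zero {p x : ℂ} (hp : ‖p‖ < 1) (hx : x ≠ 0) (h : modTheta p x ≠ 0) :
    modTheta p (1 / x) ≠ 0 := by
  rw [modTheta_one_div hp hx]
  exact mul_ne_zero (neg_ne_zero.2 (one_div_ne_zero hx)) h

lemma prod_range_succ_erase {M : Type*} [CommMonoid M] (f : ℕ → M) (k N : ℕ) :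
    ∏ i ∈ (Finset.range (k + N + 1)).erase k, f i
      = (∏ i ∈ Finset.range k, f i) * ∏ i ∈ Finset.range N, f (k + 1 + i) := by
  have : (Finset.range (k + N + 1)).erase k
      = Finset.range k ∪ (Finset.range N).map (addLeftEmbedding (k + 1)) := by
    ext i
    simp only [Finset.mem_erase, Finset.mem_range, Finset.mem_union, Finset.mem_map,
      addLeftEmbedding_apply]
    constructor
    · intro h
      rcases lt_or_ge i k with h1 | h1
      · exact .inl h1
      · exact .inr ⟨i - (k + 1), by omega, by omega⟩
    · rintro (h | ⟨j, hj, rfl⟩) <;> omega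
  rw [this, Finset.prod_union, Finset.prod_map]
  · rfl
  · rw [Finset.disjoint_left]
    intro i hi hi'
    simp only [Finset.mem_range, Finset.mem_map, addLeftEmbedding_apply] at hi hi'
    obtain ⟨j, -, rfl⟩ := hi'
    omega

/-- Lagrange interpolation for products of theta functions in the nodes `a q ^ k`. -/
lemma theta_interpolation {p q a z : ℂ} (hp : ‖p‖ < 1) (hq : q ≠ 0) (ha : a ≠ 0) (hz : z ≠ 0)
    (n : ℕ) (b : ℕ → ℂ) (hb : ∀ j, b j ≠ 0)
    (hx : ∀ i ≤ n, ∀ k ≤ n, i ≠ k →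
      modTheta p (a * q ^ i * (a * q ^ k)) * modTheta p (a * q ^ i / (a * q ^ k)) ≠ 0) :
    ∏ j ∈ Finset.range n, (modTheta p (b j * z) * modTheta p (b j / z))
      = ∑ k ∈ Finset.range (n + 1),
        (∏ j ∈ Finset.range n,
          (modTheta p (b j * (a * q ^ k)) * modTheta p (b j / (a * q ^ k)))) *
        ∏ i ∈ (Finset.range (n + 1)).erase k,
          (modTheta p (a * q ^ i * z) * modTheta p (a * q ^ i / z)) /
          (modTheta p (a * q ^ i * (a * q ^ k)) * modTheta p (a * q ^ i / (a * q ^ k))) := by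
  obtain ⟨A, B, hAB⟩ := exists_modTheta_mul_modTheta hp
  have hnode : ∀ k, a * q ^ k ≠ 0 := fun k => mul_ne_zero ha (pow_ne_zero _ hq)
  have h := homogeneous_lagrange A B (fun x y => A x * B y - B x * A y) (fun _ _ => rfl)
    (fun k => a * q ^ k) b z n (fun i hi k hk hik => by
      have := hx i hi k hk hik
      rw [hAB _ _ (hnode i) (hnode k)] at this
      exact right_ne_zero_of_mul this)
  simp only [hAB _ _ (hb _) hz, hAB _ _ (hb _) (hnode _), hAB _ _ (hnode _) hz,
    hAB _ _ (hnode _) (hnode _), Finset.prod_mul_distrib, mul_div_mul_left _ _ (hnode _)]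
  rw [h, Finset.mul_sum]
  exact Finset.sum_congr rfl fun k _ => by rw [mul_assoc]

/-- Inversion is applied to θ(q^(k+N−i)) and θ(q^(i+1)) for each i < k: the signs cancel and the
prefactors multiply to q^(k+N+1). With n = k + N this is the origin of q^(k(n+1)) and of (q^(−n))_k.
-/
lemma thetaFac_q_reflect {p q : ℂ} (hp : ‖p‖ < 1) (hq : q ≠ 0) (k N : ℕ) :
    thetaFac p q q (k + N) * thetaFac p q q k
      = q ^ (k * (k + N + 1)) * thetaFac p q (1 / q ^ (k + N)) k
        * (∏ i ∈ Finset.range k, modTheta p (q ^ i / q ^ k)) * thetaFac p q q N := by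
  have h1 : ∏ i ∈ Finset.range k, modTheta p (q ^ i / q ^ k)
      = ∏ i ∈ Finset.range k, modTheta p (1 / q ^ (i + 1)) := by
    rw [← Finset.prod_range_reflect]
    refine Finset.prod_congr rfl fun i hi => ?_
    have hi : i < k := Finset.mem_range.1 hi
    congr 1
    rw [div_eq_div_iff (pow_ne_zero _ hq) (pow_ne_zero _ hq), ← pow_add, one_mul]
    congr 1
    omega
  have h2 : thetaFac p q q (k + N)
      = thetaFac p q q N * ∏ i ∈ Finset.range k, modTheta p (q ^ (k + N - i)) := by
    rw [add_comm, thetaFac_add]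
    congr 1
    unfold thetaFac
    rw [← Finset.prod_range_reflect]
    refine Finset.prod_congr rfl fun i hi => ?_
    have hi : i < k := Finset.mem_range.1 hi
    rw [← pow_succ', ← pow_add]
    congr 2
    omega
  have h3 : q ^ (k * (k + N + 1)) = ∏ _i ∈ Finset.range k, q ^ (k + N + 1) := by
    rw [Finset.prod_const, Finset.card_range, ← pow_mul, mul_comm]
  rw [h1, h2, h3]
  have h4 : (∏ i ∈ Finset.range k, modTheta p (q ^ (k + N - i))) * thetaFac p q q k
      = (∏ _i ∈ Finset.range k, q ^ (k + N + 1)) * thetaFac p q (1 / q ^ (k + N)) k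
        * ∏ i ∈ Finset.range k, modTheta p (1 / q ^ (i + 1)) := by
    unfold thetaFac
    rw [← Finset.prod_mul_distrib, ← Finset.prod_mul_distrib, ← Finset.prod_mul_distrib]
    refine Finset.prod_congr rfl fun i hi => ?_
    have hi : i < k := Finset.mem_range.1 hi
    have e1 : 1 / q ^ (k + N) * q ^ i = 1 / q ^ (k + N - i) := by
      rw [div_mul_eq_mul_div, div_eq_div_iff (pow_ne_zero _ hq) (pow_ne_zero _ hq), one_mul,
        ← pow_add, one_mul]
      congr 1
      omega
    have e2 : q ^ (k + N + 1) = q ^ (k + N - i) * q ^ (i + 1) := by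
      rw [← pow_add]
      congr 1
      omega
    rw [e1, e2, modTheta_one_div hp (pow_ne_zero _ hq), modTheta_one_div hp (pow_ne_zero _ hq),
      ← pow_succ']
    have := pow_ne_zero (k + N - i) hq
    have := pow_ne_zero (i + 1) hq
    field_simp
  linear_combination thetaFac p q q N * h4

/-- With n = k + N, the nodes i < k and i > k contribute separate shifted factorials to the Lagrange
coefficient. What remains is a splitting of factorials in a² and the reflection
`thetaFac_q_reflect`. -/
lemma interpolation_coefficient {p q a z : ℂ} (hp : ‖p‖ < 1) (hq : q ≠ 0) (ha : a ≠ 0)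
    (k N : ℕ) (h_q : thetaFac p q q (k + N) ≠ 0)
    (hgen : ∀ j ≤ 2 * (k + N), modTheta p (a ^ 2 * q ^ j) ≠ 0)
    (h_az : thetaFac p q (a * q * z) (k + N) ≠ 0) (h_az' : thetaFac p q (a * q / z) (k + N) ≠ 0) :
    (thetaFac p q (a ^ 2 * q) (k + N) * thetaFac p q q (k + N))
        / (thetaFac p q (a * q * z) (k + N) * thetaFac p q (a * q / z) (k + N))
        * ∏ i ∈ (Finset.range (k + N + 1)).erase k,
          (modTheta p (a * q ^ i * z) * modTheta p (a * q ^ i / z)) /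
          (modTheta p (a * q ^ i * (a * q ^ k)) * modTheta p (a * q ^ i / (a * q ^ k)))
      = q ^ (k * (k + N + 1)) * (modTheta p (a ^ 2 * q ^ (2 * k)) / modTheta p (a ^ 2))
          * ((thetaFac p q (1 / q ^ (k + N)) k * thetaFac p q (a ^ 2) k
                * thetaFac p q (a * z) k * thetaFac p q (a / z) k)
            / (thetaFac p q q k * thetaFac p q (a ^ 2 * q ^ (k + N + 1)) k
                * thetaFac p q (a * q * z) k * thetaFac p q (a * q / z) k)) := by
  set X := ∏ i ∈ Finset.range k, modTheta p (q ^ i / q ^ k) with hX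
  have hsq : ∀ m r, m + r ≤ 2 * (k + N) + 1 → thetaFac p q (a ^ 2 * q ^ m) r ≠ 0 := by
    intro m r hmr
    refine thetaFac_ne_zero_iff.2 fun i hi => ?_
    rw [mul_assoc, ← pow_add]
    exact hgen _ (by omega)
  have hX0 : X ≠ 0 := by
    refine Finset.prod_ne_zero_iff.2 fun i hi => ?_
    have hi : i < k := Finset.mem_range.1 hi
    have : q ^ i / q ^ k = 1 / (q * q ^ (k - i - 1)) := by
      rw [← pow_succ', div_eq_div_iff (pow_ne_zero _ hq) (pow_ne_zero _ hq), ← pow_add, one_mul]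
      congr 1
      omega
    rw [this]
    exact modTheta_one_div_ne_zero hp (mul_ne_zero hq (pow_ne_zero _ hq))
      (thetaFac_ne_zero_iff.1 h_q _ (by omega))
  have hprod : ∏ i ∈ (Finset.range (k + N + 1)).erase k,
          (modTheta p (a * q ^ i * z) * modTheta p (a * q ^ i / z)) /
          (modTheta p (a * q ^ i * (a * q ^ k)) * modTheta p (a * q ^ i / (a * q ^ k)))
      = (thetaFac p q (a * z) k * thetaFac p q (a * q * z * q ^ k) N
          * (thetaFac p q (a / z) k * thetaFac p q (a * q / z * q ^ k) N))
        / (thetaFac p q (a ^ 2 * q ^ k) k * thetaFac p q (a ^ 2 * q ^ (2 * k + 1)) N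
          * (X * thetaFac p q q N)) := by
    rw [Finset.prod_div_distrib, Finset.prod_mul_distrib, Finset.prod_mul_distrib]
    simp only [prod_range_succ_erase]
    have e1 : ∀ i, a * q ^ i * z = a * z * q ^ i := fun i => by ring
    have e2 : ∀ i, a * q ^ (k + 1 + i) * z = a * q * z * q ^ k * q ^ i := fun i => by ring
    have e3 : ∀ i, a * q ^ i / z = a / z * q ^ i := fun i => by ring
    have e4 : ∀ i, a * q ^ (k + 1 + i) / z = a * q / z * q ^ k * q ^ i := fun i => by ring
    have e5 : ∀ i, a * q ^ i * (a * q ^ k) = a ^ 2 * q ^ k * q ^ i := fun i => by ring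
    have e6 : ∀ i, a * q ^ (k + 1 + i) * (a * q ^ k) = a ^ 2 * q ^ (2 * k + 1) * q ^ i :=
      fun i => by ring
    have e7 : ∀ i, a * q ^ i / (a * q ^ k) = q ^ i / q ^ k := fun i => mul_div_mul_left _ _ ha
    have e8 : ∀ i, q ^ (k + 1 + i) / q ^ k = q * q ^ i := fun i => by
      field_simp
      ring
    simp only [e2, e4, e6, e7, e8]
    simp only [e1, e3, e5]
    rfl
  -- Both sides are factorizations of (a²; q, p)_(2k+N+1).
  have i1 : thetaFac p q (a ^ 2 * q) (k + N) * modTheta p (a ^ 2)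
        * thetaFac p q (a ^ 2 * q ^ (k + N + 1)) k
      = thetaFac p q (a ^ 2) k * thetaFac p q (a ^ 2 * q ^ k) k * modTheta p (a ^ 2 * q ^ (2 * k))
        * thetaFac p q (a ^ 2 * q ^ (2 * k + 1)) N := by
    have l1 : thetaFac p q (a ^ 2) (k + N + 1 + k) = _ := thetaFac_add _ _ _
    rw [thetaFac_succ'] at l1
    have l2 : thetaFac p q (a ^ 2) (k + k + 1 + N) = _ := thetaFac_add _ _ _
    have l3 : thetaFac p q (a ^ 2) (k + k) = _ := thetaFac_add _ _ _
    rw [thetaFac_succ, l3, ← two_mul k, show 2 * k + 1 + N = k + N + 1 + k by ring] at l2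
    linear_combination l2 - l1
  have i2 := thetaFac_q_reflect hp hq k N
  rw [hprod]
  have f1 := hsq k k (by omega)
  have f2 := hsq (2 * k + 1) N (by omega)
  have f3 := hsq (k + N + 1) k (by omega)
  have f4 : modTheta p (a ^ 2) ≠ 0 := by simpa using hgen 0 (by omega)
  have f5 := thetaFac_ne_zero_of_le h_q (show k ≤ k + N by omega)
  have f6 := thetaFac_ne_zero_of_le h_q (show N ≤ k + N by omega)
  rw [thetaFac_add (a * q * z)] at h_az ⊢
  rw [thetaFac_add (a * q / z)] at h_az' ⊢
  have f7 := left_ne_zero_of_mul h_az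
  have f8 := right_ne_zero_of_mul h_az
  have f9 := left_ne_zero_of_mul h_az'
  have f10 := right_ne_zero_of_mul h_az'
  have i3 := congrArg₂ (· * ·) i1 i2
  rw [← hX] at i3
  generalize thetaFac p q (a ^ 2 * q) (k + N) = t1 at *
  generalize thetaFac p q q (k + N) = t2 at *
  generalize thetaFac p q (a * q * z) k = t3 at *
  generalize thetaFac p q (a * q * z * q ^ k) N = t4 at *
  generalize thetaFac p q (a * q / z) k = t5 at *
  generalize thetaFac p q (a * q / z * q ^ k) N = t6 at *
  generalize thetaFac p q (a * z) k = t7 at *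
  generalize thetaFac p q (a / z) k = t8 at *
  generalize thetaFac p q (a ^ 2 * q ^ k) k = t9 at *
  generalize thetaFac p q (a ^ 2 * q ^ (2 * k + 1)) N = t10 at *
  generalize thetaFac p q q N = t11 at *
  generalize thetaFac p q q k = t12 at *
  generalize thetaFac p q (a ^ 2 * q ^ (k + N + 1)) k = t13 at *
  generalize thetaFac p q (1 / q ^ (k + N)) k = t14 at *
  generalize thetaFac p q (a ^ 2) k = t15 at *
  generalize modTheta p (a ^ 2 * q ^ (2 * k)) = t16 at *
  generalize modTheta p (a ^ 2) = t17 at *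
  generalize q ^ (k * (k + N + 1)) = t18 at *
  clear hprod i1 i2 hsq hgen
  clear_value X
  rw [div_mul_div_comm, ← mul_div_assoc t18, div_mul_div_comm, div_eq_div_iff (by positivity)
    (by positivity)]
  linear_combination t3 * t4 * t5 * t6 * t7 * t8 * i3

/-! ### The Karlsson–Minton type identity -/

/-- The elliptic Karlsson–Minton type identity for generic `a`. -/
lemma karlsson_minton_generic {p q a z : ℂ} (hp : ‖p‖ < 1) (hq : q ≠ 0) (ha : a ≠ 0) (hz : z ≠ 0)
    (n : ℕ) (b : ℕ → ℂ) (hb : ∀ j, b j ≠ 0) (h_q : thetaFac p q q n ≠ 0)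
    (hgen : ∀ j ≤ 2 * n, modTheta p (a ^ 2 * q ^ j) ≠ 0)
    (h_az : thetaFac p q (a * q * z) n ≠ 0) (h_az' : thetaFac p q (a * q / z) n ≠ 0) :
    (thetaFac p q (a ^ 2 * q) n * thetaFac p q q n)
        / (thetaFac p q (a * q * z) n * thetaFac p q (a * q / z) n)
        * ∏ j ∈ Finset.range n, (modTheta p (b j * z) * modTheta p (b j / z))
      = ∑ k ∈ Finset.range (n + 1),
          q ^ (k * (n + 1)) * (modTheta p (a ^ 2 * q ^ (2 * k)) / modTheta p (a ^ 2))
            * ((thetaFac p q (1 / q ^ n) k * thetaFac p q (a ^ 2) k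
                  * thetaFac p q (a * z) k * thetaFac p q (a / z) k)
              / (thetaFac p q q k * thetaFac p q (a ^ 2 * q ^ (n + 1)) k
                  * thetaFac p q (a * q * z) k * thetaFac p q (a * q / z) k))
            * ∏ j ∈ Finset.range n,
              (modTheta p (a * b j * q ^ k) * modTheta p (b j / (q ^ k * a))) := by
  have hlt : ∀ i k, i < k → k ≤ n → modTheta p (q ^ k / q ^ i) ≠ 0 := by
    intro i k hik hk
    have : q ^ k / q ^ i = q * q ^ (k - i - 1) := by
      rw [div_eq_iff (pow_ne_zero _ hq), ← pow_succ', ← pow_add]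
      congr 1
      omega
    rw [this]
    exact thetaFac_ne_zero_iff.1 h_q _ (by omega)
  rw [theta_interpolation hp hq ha hz n b hb, Finset.mul_sum]
  · refine Finset.sum_congr rfl fun k hk => ?_
    obtain ⟨N, rfl⟩ := Nat.exists_eq_add_of_le (Nat.lt_succ_iff.1 (Finset.mem_range.1 hk))
    rw [← interpolation_coefficient hp hq ha k N h_q hgen h_az h_az']
    have e1 : ∀ j, a * b j * q ^ k = b j * (a * q ^ k) := fun j => by ring
    simp only [e1, mul_comm (q ^ k) a]
    ring
  · intro i hi k hk hik
    refine mul_ne_zero ?_ ?_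
    · rw [show a * q ^ i * (a * q ^ k) = a ^ 2 * q ^ (i + k) by ring]
      exact hgen _ (by omega)
    · rw [mul_div_mul_left _ _ ha]
      rcases lt_or_gt_of_ne hik with h | h
      · rw [← one_div_div]
        exact modTheta_one_div_ne_zero hp
          (div_ne_zero (pow_ne_zero _ hq) (pow_ne_zero _ hq)) (hlt i k h hk)
      · exact hlt k i h hi

/-- The elliptic Karlsson–Minton type identity. -/
lemma karlsson_minton {p q a z : ℂ} (hp : ‖p‖ < 1) (hq : q ≠ 0) (ha : a ≠ 0) (hz : z ≠ 0)
    (n : ℕ) (b : ℕ → ℂ) (hb : ∀ j, b j ≠ 0)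
    (h_a : modTheta p (a ^ 2) ≠ 0) (h_q : thetaFac p q q n ≠ 0)
    (h_aq : thetaFac p q (a ^ 2 * q ^ (n + 1)) n ≠ 0)
    (h_az : thetaFac p q (a * q * z) n ≠ 0) (h_az' : thetaFac p q (a * q / z) n ≠ 0) :
    (thetaFac p q (a ^ 2 * q) n * thetaFac p q q n)
        / (thetaFac p q (a * q * z) n * thetaFac p q (a * q / z) n)
        * ∏ j ∈ Finset.range n, (modTheta p (b j * z) * modTheta p (b j / z))
      = ∑ k ∈ Finset.range (n + 1),
          q ^ (k * (n + 1)) * (modTheta p (a ^ 2 * q ^ (2 * k)) / modTheta p (a ^ 2))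
            * ((thetaFac p q (1 / q ^ n) k * thetaFac p q (a ^ 2) k
                  * thetaFac p q (a * z) k * thetaFac p q (a / z) k)
              / (thetaFac p q q k * thetaFac p q (a ^ 2 * q ^ (n + 1)) k
                  * thetaFac p q (a * q * z) k * thetaFac p q (a * q / z) k))
            * ∏ j ∈ Finset.range n,
              (modTheta p (a * b j * q ^ k) * modTheta p (b j / (q ^ k * a))) := by
  have hqk : ∀ k : ℕ, q ^ k ≠ 0 := fun k => pow_ne_zero k hq
  have ha2 : a ^ 2 ≠ 0 := pow_ne_zero 2 ha
  have c_az : ∀ m, ContinuousAt (fun w => thetaFac p q (w * q * z) m) a :=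
    continuousAt_thetaFac_comp hp hq (by fun_prop) (mul_ne_zero (mul_ne_zero ha hq) hz)
  have c_az' : ∀ m, ContinuousAt (fun w => thetaFac p q (w * q / z) m) a :=
    continuousAt_thetaFac_comp hp hq (by fun_prop) (div_ne_zero (mul_ne_zero ha hq) hz)
  -- The hypotheses cover θ(a²q^j) only for j = 0 and n < j ≤ 2n. The values 1 ≤ j ≤ n occur in no
  -- denominator of the final identity, so both sides are continuous at a and the generic case at
  -- nearby w suffices.
  have hgen : ∀ᶠ w in 𝓝[≠] a, ∀ j ∈ Finset.range (2 * n + 1), modTheta p (w ^ 2 * q ^ j) ≠ 0 :=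
    (Finset.eventually_all _).2 fun j _ => eventually_modTheta_sq_mul_ne_zero hp ha (hqk j) h_a
  have hcont_left : ContinuousAt (fun w => (thetaFac p q (w ^ 2 * q) n * thetaFac p q q n)
        / (thetaFac p q (w * q * z) n * thetaFac p q (w * q / z) n)
        * ∏ j ∈ Finset.range n, (modTheta p (b j * z) * modTheta p (b j / z))) a := by
    refine ContinuousAt.mul (ContinuousAt.div (ContinuousAt.mul ?_ continuousAt_const)
      ((c_az n).mul (c_az' n)) (mul_ne_zero h_az h_az')) continuousAt_const
    exact continuousAt_thetaFac_comp (f := fun w => w ^ 2 * q) (a := a) hp hq (by fun_prop)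
      (mul_ne_zero ha2 hq) n
  have hcont_right : ContinuousAt (fun w => ∑ k ∈ Finset.range (n + 1),
          q ^ (k * (n + 1)) * (modTheta p (w ^ 2 * q ^ (2 * k)) / modTheta p (w ^ 2))
            * ((thetaFac p q (1 / q ^ n) k * thetaFac p q (w ^ 2) k
                  * thetaFac p q (w * z) k * thetaFac p q (w / z) k)
              / (thetaFac p q q k * thetaFac p q (w ^ 2 * q ^ (n + 1)) k
                  * thetaFac p q (w * q * z) k * thetaFac p q (w * q / z) k))
            * ∏ j ∈ Finset.range n,
              (modTheta p (w * b j * q ^ k) * modTheta p (b j / (q ^ k * w)))) a := by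
    refine tendsto_finsetSum _ fun k hk => ?_
    have hk : k ≤ n := Nat.lt_succ_iff.1 (Finset.mem_range.1 hk)
    refine ContinuousAt.mul (ContinuousAt.mul (continuousAt_const.mul (ContinuousAt.div ?_ ?_ h_a))
      (ContinuousAt.div (((continuousAt_const.mul ?_).mul ?_).mul ?_)
        (((continuousAt_const.mul ?_).mul (c_az k)).mul (c_az' k)) ?_))
      (tendsto_finsetProd _ fun j _ => ContinuousAt.mul ?_ ?_)
    · exact continuousAt_modTheta_comp hp (by fun_prop) (mul_ne_zero ha2 (hqk _))
    · exact continuousAt_modTheta_comp hp (by fun_prop) ha2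
    · exact continuousAt_thetaFac_comp hp hq (by fun_prop) ha2 k
    · exact continuousAt_thetaFac_comp (f := fun w => w * z) (a := a) hp hq (by fun_prop)
        (mul_ne_zero ha hz) k
    · exact continuousAt_thetaFac_comp (f := fun w => w / z) (a := a) hp hq (by fun_prop)
        (div_ne_zero ha hz) k
    · exact continuousAt_thetaFac_comp (f := fun w => w ^ 2 * q ^ (n + 1)) (a := a) hp hq
        (by fun_prop) (mul_ne_zero ha2 (hqk _)) k
    · exact mul_ne_zero (mul_ne_zero (mul_ne_zero (thetaFac_ne_zero_of_le h_q hk)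
        (thetaFac_ne_zero_of_le h_aq hk)) (thetaFac_ne_zero_of_le h_az hk))
        (thetaFac_ne_zero_of_le h_az' hk)
    · exact continuousAt_modTheta_comp hp (by fun_prop) (mul_ne_zero (mul_ne_zero ha (hb j)) (hqk k))
    · have := mul_ne_zero (hqk k) ha
      exact continuousAt_modTheta_comp hp (by fun_prop (disch := assumption)) (div_ne_zero (hb j) this)
  refine tendsto_nhds_unique_of_eventuallyEq (l := 𝓝[≠] a)
    (hcont_left.tendsto.mono_left nhdsWithin_le_nhds)
    (hcont_right.tendsto.mono_left nhdsWithin_le_nhds) ?_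
  filter_upwards [hgen, nhdsWithin_le_nhds ((c_az n).eventually_ne h_az),
    nhdsWithin_le_nhds ((c_az' n).eventually_ne h_az'),
    nhdsWithin_le_nhds (eventually_ne_nhds ha)] with w h1 h2 h3 h4
  exact karlsson_minton_generic hp hq h4 hz n b hb h_q
    (fun j hj => h1 j (Finset.mem_range.2 (by omega))) h2 h3

/-! ### Geometric parameters and the ₁₂V₁₁ series -/

lemma thetaFac_one_div_pow_eq_zero {p q : ℂ} (hq : q ≠ 0) {n k : ℕ} (h : n < k) :
    thetaFac p q (1 / q ^ n) k = 0 := by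
  refine Finset.prod_eq_zero (Finset.mem_range.2 h) ?_
  rw [one_div_mul_cancel (pow_ne_zero _ hq), modTheta_one_right]

lemma thetaFac_shift_comm {p q : ℂ} (x : ℂ) (k s : ℕ) :
    thetaFac p q (x * q ^ k) s * thetaFac p q x k = thetaFac p q x s * thetaFac p q (x * q ^ s) k := by
  rw [← thetaFac_add, add_comm s k, thetaFac_add, mul_comm]

/-- Induction on k: with x = b/(q^(k+1) a), the quotient (x)_s/(xq)_s is θ(x)/θ(xq^s), which
inversion turns into q^(−s) θ(1/x)/θ(1/(xq^s)), the quotient of the new factors. -/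
lemma thetaFac_div_shift {p q a b : ℂ} (hp : ‖p‖ < 1) (hq : q ≠ 0) (ha : a ≠ 0) (hb : b ≠ 0)
    (s k : ℕ) :
    q ^ (s * k) * thetaFac p q (b / (q ^ k * a)) s * thetaFac p q (a * q / (b * q ^ s)) k
      = thetaFac p q (a * q / b) k * thetaFac p q (b / a) s := by
  induction k with
  | zero => simp [thetaFac]
  | succ k ih =>
    have hk := pow_ne_zero k hq
    have hs := pow_ne_zero s hq
    set x := b / (q ^ (k + 1) * a) with hx
    have hx0 : x ≠ 0 := div_ne_zero hb (mul_ne_zero (pow_ne_zero _ hq) ha)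
    have e1 : b / (q ^ k * a) = x * q := by
      rw [hx]
      field_simp
      ring
    have e2 : a * q / b * q ^ k = 1 / x := by
      rw [hx]
      field_simp
      ring
    have e3 : a * q / (b * q ^ s) * q ^ k = 1 / (x * q ^ s) := by
      rw [hx]
      field_simp
      ring
    have h1 : thetaFac p q x s * modTheta p (x * q ^ s) = modTheta p x * thetaFac p q (x * q) s := by
      rw [← thetaFac_succ, thetaFac_succ']
    rw [thetaFac_succ, thetaFac_succ, e2, e3, modTheta_one_div hp hx0,
      modTheta_one_div hp (mul_ne_zero hx0 hs), mul_add, mul_one, pow_add]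
    rw [e1] at ih
    have h2 : q ^ s * (1 / (x * q ^ s)) = 1 / x := by field_simp
    linear_combination (-(1 / x) * modTheta p x) * ih
      - q ^ (s * k) * thetaFac p q (a * q / (b * q ^ s)) k * thetaFac p q x s
        * modTheta p (x * q ^ s) * h2
      - q ^ (s * k) * thetaFac p q (a * q / (b * q ^ s)) k * (1 / x) * h1

/-- The arguments of the factors of (b/a)_s are the reciprocals, in reverse order, of those of the
first s factors of (aq^(1−s)/b)_n. -/
lemma thetaFac_div_ne_zero {p q a b : ℂ} (hp : ‖p‖ < 1) (hq : q ≠ 0) (ha : a ≠ 0) (hb : b ≠ 0)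
    {s n : ℕ} (hs : s ≤ n) (h : thetaFac p q (a * q / (b * q ^ s)) n ≠ 0) :
    thetaFac p q (b / a) s ≠ 0 := by
  refine thetaFac_ne_zero_iff.2 fun i hi => ?_
  have h1 := thetaFac_ne_zero_iff.1 h (s - 1 - i) (by omega)
  have h2 : b / a * q ^ i = 1 / (a * q / (b * q ^ s) * q ^ (s - 1 - i)) := by
    have hqs : q ^ s = q ^ i * q ^ (s - 1 - i) * q := by
      rw [← pow_add, ← pow_succ]
      congr 1
      omega
    have := pow_ne_zero i hq
    have := pow_ne_zero (s - 1 - i) hq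
    rw [hqs]
    field_simp
  rw [h2]
  exact modTheta_one_div_ne_zero hp (mul_ne_zero (div_ne_zero (mul_ne_zero ha hq)
    (mul_ne_zero hb (pow_ne_zero _ hq))) (pow_ne_zero _ hq)) h1

/-- The products over a geometric string of parameters `b, bq, …, bq^(s-1)`. -/
lemma prod_geometric_parameters {p q a b : ℂ} (hp : ‖p‖ < 1) (hq : q ≠ 0) (ha : a ≠ 0)
    (hb : b ≠ 0) {s n k : ℕ} (hs : s ≤ n) (hk : k ≤ n) (h_ab : thetaFac p q (a * b) n ≠ 0)
    (h_b : thetaFac p q (a * q / (b * q ^ s)) n ≠ 0) :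
    (∏ j ∈ Finset.range s,
        (modTheta p (a * (b * q ^ j) * q ^ k) * modTheta p (b * q ^ j / (q ^ k * a))))
      / (thetaFac p q (a * b) s * thetaFac p q (b / a) s)
      = thetaFac p q (a * q / b) k * thetaFac p q (a * b * q ^ s) k
        / (thetaFac p q (a * b) k * thetaFac p q (a * q / (b * q ^ s)) k) / q ^ (s * k) := by
  have e1 : ∀ j, a * (b * q ^ j) * q ^ k = a * b * q ^ k * q ^ j := fun j => by ring
  have e2 : ∀ j, b * q ^ j / (q ^ k * a) = b / (q ^ k * a) * q ^ j := fun j => by ring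
  simp only [e1, e2, Finset.prod_mul_distrib]
  change thetaFac p q (a * b * q ^ k) s * thetaFac p q (b / (q ^ k * a)) s / _ = _
  have h1 := thetaFac_shift_comm (p := p) (q := q) (a * b) k s
  have h2 := thetaFac_div_shift hp hq ha hb s k
  rw [div_div, div_eq_div_iff
    (mul_ne_zero (thetaFac_ne_zero_of_le h_ab hs) (thetaFac_div_ne_zero hp hq ha hb hs h_b))
    (mul_ne_zero (mul_ne_zero (thetaFac_ne_zero_of_le h_ab hk) (thetaFac_ne_zero_of_le h_b hk))
      (pow_ne_zero _ hq))]
  linear_combination (q ^ (s * k) * thetaFac p q (b / (q ^ k * a)) s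
      * thetaFac p q (a * q / (b * q ^ s)) k) * h1
    + thetaFac p q (a * b) s * thetaFac p q (a * b * q ^ s) k * h2

theorem corollary2p6 (p q a z : ℂ) (n : ℕ) (hp : ‖p‖ < 1)
    (hq : q ≠ 0) (ha : a ≠ 0) (hz : z ≠ 0)
    -- none of the denominators vanishes
    (h_a : modTheta p (a ^ 2) ≠ 0)
    (h_q : thetaFac p q q n ≠ 0)
    (h_aq : thetaFac p q (a ^ 2 * q ^ (n + 1)) n ≠ 0)
    (h_az : thetaFac p q (a * q * z) n ≠ 0)
    (h_az' : thetaFac p q (a * q / z) n ≠ 0) :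
    -- the elliptic Karlsson-Minton type identity
    (∀ b : Fin n → ℂ, (∀ j, b j ≠ 0) →
      (thetaFac p q (a ^ 2 * q) n * thetaFac p q q n)
          / (thetaFac p q (a * q * z) n * thetaFac p q (a * q / z) n)
          * ∏ j, (modTheta p (b j * z) * modTheta p (b j / z))
        = ∑ k ∈ Finset.range (n + 1),
            q ^ (k * (n + 1)) * (modTheta p (a ^ 2 * q ^ (2 * k)) / modTheta p (a ^ 2))
              * ((thetaFac p q (1 / q ^ n) k * thetaFac p q (a ^ 2) k
                    * thetaFac p q (a * z) k * thetaFac p q (a / z) k)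
                / (thetaFac p q q k * thetaFac p q (a ^ 2 * q ^ (n + 1)) k
                    * thetaFac p q (a * q * z) k * thetaFac p q (a * q / z) k))
              * ∏ j, (modTheta p (a * b j * q ^ k) * modTheta p (b j / (q ^ k * a))))
    ∧
    -- the special case of a terminating `₁₂V₁₁` series
    (∀ (s : ℕ) (b d : ℂ), s ≤ n → b ≠ 0 → d ≠ 0 →
      thetaFac p q (a * b) n ≠ 0 → thetaFac p q (a * d) n ≠ 0 →
      thetaFac p q (a * q / (b * q ^ s)) n ≠ 0 →
      thetaFac p q (a * q / (d * q ^ (n - s))) n ≠ 0 →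
      (thetaFac p q q n * thetaFac p q (a ^ 2 * q) n)
          / (thetaFac p q (a * q * z) n * thetaFac p q (a * q / z) n)
          * ((thetaFac p q (b * z) s * thetaFac p q (b / z) s
                * (thetaFac p q (d * z) (n - s) * thetaFac p q (d / z) (n - s)))
            / (thetaFac p q (a * b) s * thetaFac p q (b / a) s
                * (thetaFac p q (a * d) (n - s) * thetaFac p q (d / a) (n - s))))
        = ellipticV p q (a ^ 2)
            [1 / q ^ n, a * z, a / z, a * q / b, a * q / d, a * b * q ^ s,
              a * d * q ^ (n - s)]) := by
  constructor
  · intro b hb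
    -- The value 1 beyond n enters no product; it only has to be nonzero.
    have h := karlsson_minton hp hq ha hz n (fun j => if h : j < n then b ⟨j, h⟩ else 1)
      (fun j => by split_ifs with hj; exacts [hb _, one_ne_zero]) h_a h_q h_aq h_az h_az'
    simpa only [Finset.prod_range, Fin.is_lt, dite_true, Fin.eta] using h
  · intro s b d hs hb hd h_ab h_ad h_b h_d
    obtain ⟨t, rfl⟩ := Nat.exists_eq_add_of_le hs
    rw [Nat.add_sub_cancel_left] at *
    -- Parameters b, bq, …, bq^(s−1), d, dq, …, dq^(t−1) with t = n − s, for which the theta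
    -- products become shifted factorials.
    have h := karlsson_minton hp hq ha hz (s + t)
      (fun j => if j < s then b * q ^ j else d * q ^ (j - s))
      (fun j => by
        split_ifs
        exacts [mul_ne_zero hb (pow_ne_zero _ hq), mul_ne_zero hd (pow_ne_zero _ hq)])
      h_a h_q h_aq h_az h_az'
    have hsplit : ∀ f : ℂ → ℂ,
        ∏ j ∈ Finset.range (s + t), f (if j < s then b * q ^ j else d * q ^ (j - s))
          = (∏ j ∈ Finset.range s, f (b * q ^ j)) * ∏ j ∈ Finset.range t, f (d * q ^ j) := by
      intro f
      rw [Finset.prod_range_add]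
      congr 1
      · exact Finset.prod_congr rfl fun j hj => by rw [if_pos (Finset.mem_range.1 hj)]
      · exact Finset.prod_congr rfl fun j _ => by
          rw [if_neg (by omega), Nat.add_sub_cancel_left]
    rw [hsplit fun x => modTheta p (x * z) * modTheta p (x / z)] at h
    have hz1 : ∀ c m, ∏ j ∈ Finset.range m, (modTheta p (c * q ^ j * z) * modTheta p (c * q ^ j / z))
        = thetaFac p q (c * z) m * thetaFac p q (c / z) m := by
      intro c m
      rw [Finset.prod_mul_distrib]
      simp only [mul_right_comm c _ z, mul_div_right_comm c _ z]
      rfl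
    rw [hz1, hz1] at h
    have hV : ellipticV p q (a ^ 2)
          [1 / q ^ (s + t), a * z, a / z, a * q / b, a * q / d, a * b * q ^ s, a * d * q ^ t]
        = ∑ k ∈ Finset.range (s + t + 1), modTheta p (a ^ 2 * q ^ (2 * k)) / modTheta p (a ^ 2)
          * ((thetaFac p q (a ^ 2) k * (thetaFac p q (1 / q ^ (s + t)) k * (thetaFac p q (a * z) k
              * (thetaFac p q (a / z) k * (thetaFac p q (a * q / b) k * (thetaFac p q (a * q / d) k
              * (thetaFac p q (a * b * q ^ s) k * thetaFac p q (a * d * q ^ t) k)))))))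
            / (thetaFac p q q k * (thetaFac p q (a ^ 2 * q ^ (s + t + 1)) k
              * (thetaFac p q (a * q / z) k * (thetaFac p q (a * q * z) k
              * (thetaFac p q (a * b) k * (thetaFac p q (a * d) k
              * (thetaFac p q (a * q / (b * q ^ s)) k
              * thetaFac p q (a * q / (d * q ^ t)) k)))))))) * q ^ k := by
      have hqs := pow_ne_zero s hq
      have hqt := pow_ne_zero t hq
      have e1 : a ^ 2 * q / (1 / q ^ (s + t)) = a ^ 2 * q ^ (s + t + 1) := by
        rw [div_div_eq_mul_div, div_one, pow_succ]
        ring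
      have e2 : a ^ 2 * q / (a * z) = a * q / z := by field_simp
      have e3 : a ^ 2 * q / (a / z) = a * q * z := by field_simp
      have e4 : a ^ 2 * q / (a * q / b) = a * b := by field_simp
      have e5 : a ^ 2 * q / (a * q / d) = a * d := by field_simp
      have e6 : a ^ 2 * q / (a * b * q ^ s) = a * q / (b * q ^ s) := by field_simp
      have e7 : a ^ 2 * q / (a * d * q ^ t) = a * q / (d * q ^ t) := by field_simp
      unfold ellipticV
      simp only [List.map_cons, List.map_nil, List.prod_cons, List.prod_nil, mul_one, e1, e2, e3,
        e4, e5, e6, e7]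
      -- Beyond n the numerator contains (q^(−n))_k, which has the factor θ(1) = 0; the term is then
      -- 0 even if its denominator vanishes.
      refine tsum_eq_sum fun k hk => ?_
      rw [thetaFac_one_div_pow_eq_zero hq (by simpa using hk)]
      simp
    rw [hV, mul_comm (thetaFac p q q (s + t)), ← mul_div_assoc, h, Finset.sum_div]
    refine Finset.sum_congr rfl fun k hk => ?_
    have hk : k ≤ s + t := Nat.lt_succ_iff.1 (Finset.mem_range.1 hk)
    have hB := prod_geometric_parameters hp hq ha hb hs hk h_ab h_b
    have hD := prod_geometric_parameters hp hq ha hd (Nat.le_add_left t s) hk h_ad h_d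
    rw [hsplit fun x => modTheta p (a * x * q ^ k) * modTheta p (x / (q ^ k * a)), mul_div_assoc,
      mul_div_mul_comm (Finset.prod (Finset.range s) _), hB, hD]
    -- The two strings absorb q^(sk) and q^(tk), leaving exactly the q^k of the very-well-poised
    -- series.
    have hqq : q ^ (k * (s + t + 1)) = q ^ (s * k) * q ^ (t * k) * q ^ k := by
      rw [← pow_add, ← pow_add]
      congr 1
      ring
    have hqs := pow_ne_zero (s * k) hq
    have hqt := pow_ne_zero (t * k) hq
    have hcancel : ∀ u T F X Y : ℂ, q ^ (s * k) * q ^ (t * k) * u * T * F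
        * (X / q ^ (s * k) * (Y / q ^ (t * k))) = u * T * F * (X * Y) := fun u T F X Y => by
      generalize q ^ (s * k) = v at *
      generalize q ^ (t * k) = w at *
      field_simp
    rw [hqq, hcancel]
    ring
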